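/- Let $(X,S,Y)$ be random variables on a probability space with values in $\mathcal X\times\{0,1\}\times\mathbb R$, where $\mathcal X\subseteq\mathbb R^d$, and let $r_s=P(S=s)>0$ for $s=0,1$. For a measurable $g:\mathcal X\times\{0,1\}\to\mathbb R$, let the law of $g(X^s,s)$ denote the conditional law of $g(X,s)$ given $S=s$. Let $\mathcal L:\mathbb R\times\mathbb R\to\mathbb R_{\ge 0}$ be a measurable loss function. Let $f^*:\mathcal X\times\{0,1\}\to\mathbb R$ be a measurable function such that $Y$ and $(X,S)$ are conditionally independent given $f^*(X,S)$, and let $F(\cdot\mid\theta)$ be a (regular) conditional distribution of $Y$ given $f^*(X,S)=\theta$. Assume that the induced cost $$\mathcal C(x,y)=\int \mathcal L(y,t)\,dF(t\mid x)$$ is finite for all $x,y\in\mathbb R$, is twice differentiable on $\mathbb R^2$, and satisfies $\dfrac{\partial^2\mathcal C(x,y)}{\partial x\,\partial y}<0$ for all $x,y\in\mathbb R$. Assume that the law $\nu_{f^*|s}$ of $f^*(X^s,s)$ is non-atomic for $s=0,1$, and let $F^*_s$ be its distribution function. For a probability measure $\nu$ on $\mathbb R$ with distribution function $F_\nu$,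 let $Q_\nu(u)=\inf\{t: F_\nu(t)\ge u\}$, $0<u<1$, be its quantile function. (i) Let $f$ be a solution of the fair regression problem, i.e. $f$ minimizes $\mathbb E[\mathcal L(f(X,S),Y)]$ over all measurable $f:\mathcal X\times\{0,1\}\to\mathbb R$ such that $f(X^0,0)$ and $f(X^1,1)$ have the same distribution, and suppose that the minimal risk is finite. Then $f$ belongs to the class $\{Q\circ F^*_s\circ f^*(x,s): Q \text{ is a quantile function}\}$, i.e. there is a quantile function $Q$ of a probability distribution on $\mathbb R$ such that $f(X,S)=Q(F^*_S(f^*(X,S)))$ almost surely. (ii) Let $\bar\nu$ be a minimizer, with finite minimal value, of $\nu\mapsto\sum_{s=0}^1 r_s\inf_{\gamma\in\Pi(\nu_{f^*|s},\nu)}\int\mathcal C\,d\gamma$ over all probability measures $\nu$ on $\mathbb R$, where $\Pi(\mu,\nu)$ is the set of joint distributions with marginals $\mu$ and $\nu$, and for $s=0,1$ let $T_s$ be an optimal transport map from $\nu_{f^*|s}$ to $\bar\nu$ for the cost $\mathcal C$, i.e. $(T_s)_\#\nu_{f^*|s}=\bar\nu$ and $\int\mathcal C(x,T_s(x))\,d\nu_{f^*|s}(x)$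 equals the infimum over $\Pi(\nu_{f^*|s},\bar\nu)$. Then $T_s=Q_{\bar\nu}\circ F^*_s$ holds $\nu_{f^*|s}$-almost everywhere, for $s=0,1$. -/

import Mathlib

open MeasureTheory ProbabilityTheory
open scoped ENNReal NNReal

namespace FairRegression

noncomputable section

/-! ### Quantile functions -/

/-- The quantile function `Q_ν(u) = inf {t : u ≤ F_ν(t)}` of a probability measure `ν` on `ℝ`,
where `F_ν` is the distribution function of `ν`; it is meaningful for `0 < u < 1`. -/
def quantile (ν : Measure ℝ) (u : ℝ) : ℝ :=
  sInf {t : ℝ | u ≤ cdf ν t}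

/-- `Q` is a quantile function: on the open unit interval it is the quantile function of some
probability distribution on `ℝ`. -/
def IsQuantileFunction (Q : ℝ → ℝ) : Prop :=
  ∃ ν : Measure ℝ, IsProbabilityMeasure ν ∧ ∀ u ∈ Set.Ioo (0 : ℝ) 1, Q u = quantile ν u

/-! ### Conditional independence -/

/-- The random variables `V` and `W` are conditionally independent given the random variable `Z`:
`P(V ∈ A, W ∈ B | Z) = P(V ∈ A | Z) P(W ∈ B | Z)` almost surely for all measurable `A`, `B`.
(Mathlib's `CondIndepFun` is this notion for standard Borel `Ω` only.) -/
def CondIndepGiven {Ω α β δ : Type*} [MeasurableSpace Ω] [MeasurableSpace α] [MeasurableSpace β]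
    [MeasurableSpace δ] (P : Measure Ω) (V : Ω → α) (W : Ω → β) (Z : Ω → δ) : Prop :=
  ∀ (A : Set α) (B : Set β), MeasurableSet A → MeasurableSet B →
    P⟦V ⁻¹' A ∩ W ⁻¹' B | MeasurableSpace.comap Z inferInstance⟧ =ᵐ[P]
      fun ω ↦ (P⟦V ⁻¹' A | MeasurableSpace.comap Z inferInstance⟧) ω *
        (P⟦W ⁻¹' B | MeasurableSpace.comap Z inferInstance⟧) ω

/-! ### The fair regression problem -/

section Problem

variable {Ω E : Type*} [MeasurableSpace Ω] [MeasurableSpace E]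

/-- The law of `g(X^s, s)`, i.e. the conditional law of `g(X, s)` given `S = s`. -/
def groupLaw (P : Measure Ω) (X : Ω → E) (S : Ω → Fin 2) (g : E × Fin 2 → ℝ) (s : Fin 2) :
    Measure ℝ :=
  (ProbabilityTheory.cond P (S ⁻¹' {s})).map (fun ω ↦ g (X ω, s))

/-- Demographic parity: `f(X^0, 0)` and `f(X^1, 1)` have the same distribution. -/
def IsFair (P : Measure Ω) (X : Ω → E) (S : Ω → Fin 2) (f : E × Fin 2 → ℝ) : Prop :=
  groupLaw P X S f 0 = groupLaw P X S f 1

/-- The risk `E[L(f(X, S), Y)]`, with values in `[0, ∞]`. -/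
def risk (P : Measure Ω) (X : Ω → E) (S : Ω → Fin 2) (Y : Ω → ℝ) (L : ℝ → ℝ → ℝ≥0)
    (f : E × Fin 2 → ℝ) : ℝ≥0∞ :=
  ∫⁻ ω, (L (f (X ω, S ω)) (Y ω) : ℝ≥0∞) ∂P

/-- `f` solves the fair regression problem: it is a (measurable) fair prediction function that
minimizes the risk among all fair prediction functions. -/
def IsFairRiskMinimizer (P : Measure Ω) (X : Ω → E) (S : Ω → Fin 2) (Y : Ω → ℝ)
    (L : ℝ → ℝ → ℝ≥0) (f : E × Fin 2 → ℝ) : Prop :=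
  Measurable f ∧ IsFair P X S f ∧
    ∀ g : E × Fin 2 → ℝ, Measurable g → IsFair P X S g → risk P X S Y L f ≤ risk P X S Y L g

end Problem

/-- The induced cost `C(x, y) = ∫ L(y, t) dF(t | x)`. -/
def inducedCost (L : ℝ → ℝ → ℝ≥0) (F : Kernel ℝ ℝ) (x y : ℝ) : ℝ :=
  ∫ t, (L y t : ℝ) ∂(F x)

/-- `c` is twice differentiable on `ℝ × ℝ`. -/
def TwiceDifferentiable (c : ℝ → ℝ → ℝ) : Prop :=
  Differentiable ℝ (fun p : ℝ × ℝ ↦ c p.1 p.2) ∧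
    Differentiable ℝ (fderiv ℝ (fun p : ℝ × ℝ ↦ c p.1 p.2))

/-- The mixed partial derivative `∂²c(x, y) / ∂x∂y`. -/
def mixedPartial (c : ℝ → ℝ → ℝ) (x y : ℝ) : ℝ :=
  deriv (fun u ↦ deriv (fun v ↦ c u v) y) x

/-! ### Kantorovich problem and Kantorovich barycenters -/

/-- The transport cost `E_γ[c(U*, U)]` of a plan `γ`, for a nonnegative cost `c`. -/
def planCost (c : ℝ → ℝ → ℝ) (γ : Measure (ℝ × ℝ)) : ℝ≥0∞ :=
  ∫⁻ p, ENNReal.ofReal (c p.1 p.2) ∂γ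

/-- The value of the Kantorovich problem: the infimum of the transport cost over all joint
distributions with marginals `μ` and `ν`. -/
def kantorovichCost (c : ℝ → ℝ → ℝ) (μ ν : Measure ℝ) : ℝ≥0∞ :=
  ⨅ (γ : Measure (ℝ × ℝ)) (_ : γ.map Prod.fst = μ ∧ γ.map Prod.snd = ν), planCost c γ

/-- `T` is an optimal transport map from `μ` to `ν`: `T_# μ = ν`, and the plan `(id, T)_# μ`
attains the infimum in the Kantorovich problem. -/
def IsOptimalTransportMap (c : ℝ → ℝ → ℝ) (μ ν : Measure ℝ) (T : ℝ → ℝ) : Prop :=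
  Measurable T ∧ μ.map T = ν ∧ planCost c (μ.map (fun x ↦ (x, T x))) = kantorovichCost c μ ν

/-- The objective `∑ₛ rₛ inf_{γ ∈ Π(μₛ, ν)} E_γ[c]` of the Kantorovich barycenter problem. -/
def barycenterObjective (c : ℝ → ℝ → ℝ) (r : Fin 2 → ℝ≥0∞) (μ : Fin 2 → Measure ℝ)
    (ν : Measure ℝ) : ℝ≥0∞ :=
  ∑ s, r s * kantorovichCost c (μ s) ν

/-- `ν` solves the Kantorovich barycenter problem, with a finite minimal value. -/
def IsKantorovichBarycenter (c : ℝ → ℝ → ℝ) (r : Fin 2 → ℝ≥0∞) (μ : Fin 2 → Measure ℝ)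
    (ν : Measure ℝ) : Prop :=
  IsProbabilityMeasure ν ∧ barycenterObjective c r μ ν < ∞ ∧
    ∀ ν' : Measure ℝ, IsProbabilityMeasure ν' →
      barycenterObjective c r μ ν ≤ barycenterObjective c r μ ν'

end

end FairRegression

/-!
The negative mixed partial derivative makes the induced cost `C` strictly submodular: exchanging the
second coordinates of two pairs that are in opposite order strictly lowers the cost
(`strictSubmodular_of_mixedPartial_neg`). Hence a cost-minimizing coupling of `μ` and `ν` cannot
charge, for any `(q, q')`, both the quadrant `{x < q, y > q'}` and the quadrant `{x > q, y < q'}`.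
When `μ` is non-atomic, the only coupling with this property is the quantile coupling
`y = Q_ν(F_μ(x))` (`ae_eq_quantile_cdf`).

The exchange is carried out on two pieces of equal mass in the two quadrants. It need not be the
product exchange: any rearrangement that swaps the second marginals of the pieces improves the cost,
since against the separable comparison cost `C(x, q') + C(q, y) - C(q, q')`, which only sees
marginals, crossing pairs are worse and non-crossing pairs better. As the first marginal is
non-atomic, the rearrangement can be realized by a function `G` of the old pair
(`exists_rearrangement_lintegral_lt`, with `exists_measurable_map_eq`). This is what makes the same
argument serve both claims. For an optimal transport map the rearranged plan contradicts optimality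
(`optimalTransportMap_ae_eq_quantile_cdf`); beyond finiteness of the cost, nothing about the
barycenter is used. For a fair risk minimizer `f`, conditional independence turns the risk into
`∑ₛ rₛ E[C(f*(Xˢ, s), f(Xˢ, s))]` (`risk_eq_lintegral_inducedCost`), and replacing `f` by
`G(f*, f)` in one group gives a fair prediction function of smaller risk
(`IsFairRiskMinimizer.ae_eq_quantile_cdf`). No existence or optimality theorem for couplings is
needed.
-/

namespace FairRegression

open Set Filter Topology

/-! ### Distribution functions of non-atomic measures -/

theorem continuous_cdf (μ : Measure ℝ) [IsProbabilityMeasure μ] [NullSingletonClass μ] :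
    Continuous (cdf μ) := by
  refine continuous_iff_continuousAt.2 fun x ↦ ?_
  rw [(monotone_cdf μ).continuousAt_iff_leftLim_eq_rightLim, (cdf μ).rightLim_eq]
  have h := (cdf μ).measure_singleton x
  rw [measure_cdf, measure_singleton, eq_comm, ENNReal.ofReal_eq_zero] at h
  exact le_antisymm ((monotone_cdf μ).leftLim_le le_rfl) (by linarith)

/-- A level set of the distribution function is an interval on which the distribution function
does not grow. -/
theorem measure_cdf_eq_const (μ : Measure ℝ) [IsProbabilityMeasure μ] [NullSingletonClass μ]
    (u : ℝ) : μ {x | cdf μ x = u} = 0 := by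
  have hmeas : MeasurableSet {x | cdf μ x = u} :=
    (isClosed_singleton.preimage (continuous_cdf μ)).measurableSet
  rw [hmeas.measure_eq_iSup_isCompact]
  simp only [ENNReal.iSup_eq_zero]
  intro K hKu hK
  rcases K.eq_empty_or_nonempty with rfl | hne
  · simp
  have ha : cdf μ (sInf K) = u := hKu (hK.sInf_mem hne)
  have hb : cdf μ (sSup K) = u := hKu (hK.sSup_mem hne)
  refine measure_mono_null (subset_Icc_csInf_csSup hK.bddBelow hK.bddAbove) ?_
  rw [← Ioc_ae_eq_Icc.measure_eq]
  conv_lhs => rw [← measure_cdf μ]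
  rw [StieltjesFunction.measure_Ioc, ha, hb]
  simp

/-- The distribution function of a non-atomic law is uniformly distributed on `[0, 1]`. -/
theorem measure_cdf_le (μ : Measure ℝ) [IsProbabilityMeasure μ] [NullSingletonClass μ]
    {p : ℝ} (h0 : 0 ≤ p) (h1 : p ≤ 1) : μ {x | cdf μ x ≤ p} = ENNReal.ofReal p := by
  rcases h0.eq_or_lt with rfl | h0
  · have : {x | cdf μ x ≤ 0} = {x | cdf μ x = 0} := by
      ext x; exact ⟨fun h ↦ le_antisymm h (cdf_nonneg μ x), fun h ↦ le_of_eq h⟩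
    rw [this, measure_cdf_eq_const, ENNReal.ofReal_zero]
  rcases h1.eq_or_lt with rfl | h1
  · have : {x | cdf μ x ≤ 1} = univ := eq_univ_of_forall fun x ↦ cdf_le_one μ x
    rw [this, measure_univ, ENNReal.ofReal_one]
  obtain ⟨a, ha⟩ : ∃ a, cdf μ a = p :=
    mem_range_of_exists_le_of_exists_ge (continuous_cdf μ)
      (((tendsto_cdf_atBot μ).eventually (gt_mem_nhds h0)).exists.imp fun _ h ↦ h.le)
      (((tendsto_cdf_atTop μ).eventually (lt_mem_nhds h1)).exists.imp fun _ h ↦ h.le)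
  have hae : {x | cdf μ x ≤ p} =ᵐ[μ] Iic a := by
    have h : ∀ᵐ x ∂μ, cdf μ x ≠ p := measure_eq_zero_iff_ae_notMem.1 (measure_cdf_eq_const μ p)
    filter_upwards [h] with x hx
    refine propext ⟨fun h : cdf μ x ≤ p ↦ ?_, fun h : x ≤ a ↦ ?_⟩
    · exact ((monotone_cdf μ).reflect_lt ((lt_of_le_of_ne h hx).trans_eq ha.symm)).le
    · exact (monotone_cdf μ h).trans_eq ha
  rw [measure_congr hae, ← ofReal_cdf, ha]

/-- A non-atomic law on `ℝ` can be transported onto every law by a map: its distribution function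
pushes it to the uniform law, of which every law is an image. -/
theorem exists_measurable_map_eq_of_isProbabilityMeasure (μ ν : Measure ℝ)
    [IsProbabilityMeasure μ] [IsProbabilityMeasure ν] [NullSingletonClass μ] :
    ∃ T : ℝ → ℝ, Measurable T ∧ μ.map T = ν := by
  obtain ⟨q, hq, hqν⟩ := ν.exists_measurable_map_eq
  let G : ℝ → unitInterval := fun x ↦ ⟨cdf μ x, cdf_nonneg μ x, cdf_le_one μ x⟩
  have hG : Measurable G := (continuous_cdf μ).measurable.subtype_mk
  have hGμ : μ.map G = volume := by
    have : IsProbabilityMeasure (μ.map G) := Measure.isProbabilityMeasure_map hG.aemeasurable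
    refine Measure.ext_of_Iic _ _ fun a ↦ ?_
    rw [Measure.map_apply hG measurableSet_Iic, unitInterval.volume_Iic]
    exact measure_cdf_le μ a.2.1 a.2.2
  exact ⟨q ∘ G, hq.comp hG, by rw [← Measure.map_map hq hG, hGμ, hqν]⟩

theorem isProbabilityMeasure_inv_smul {α : Type*} [MeasurableSpace α] (μ : Measure α)
    [IsFiniteMeasure μ] (hμ : μ ≠ 0) : IsProbabilityMeasure ((μ univ)⁻¹ • μ) :=
  ⟨by simpa using ENNReal.inv_mul_cancel (by simpa using hμ) (measure_ne_top μ univ)⟩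

theorem nullSingletonClass_smul {α : Type*} [MeasurableSpace α] (μ : Measure α)
    [NullSingletonClass μ] (c : ℝ≥0∞) : NullSingletonClass (c • μ) :=
  ⟨fun x ↦ by simp⟩

theorem exists_measurable_map_eq (μ ν : Measure ℝ) [IsFiniteMeasure μ] [IsFiniteMeasure ν]
    [NullSingletonClass μ] (h : μ univ = ν univ) : ∃ T : ℝ → ℝ, Measurable T ∧ μ.map T = ν := by
  rcases eq_or_ne μ 0 with rfl | hμ
  · exact ⟨id, measurable_id, by simpa using (Measure.measure_univ_eq_zero.1 h.symm).symm⟩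
  have hν : ν ≠ 0 := by rintro rfl; exact hμ (by simpa using h)
  have := isProbabilityMeasure_inv_smul μ hμ
  have := isProbabilityMeasure_inv_smul ν hν
  have := nullSingletonClass_smul μ (μ univ)⁻¹
  obtain ⟨T, hT, hTν⟩ := exists_measurable_map_eq_of_isProbabilityMeasure
    ((μ univ)⁻¹ • μ) ((ν univ)⁻¹ • ν)
  refine ⟨T, hT, ?_⟩
  have h0 : μ univ ≠ 0 := by simpa using hμ
  have := congrArg (fun m ↦ μ univ • m) hTν
  simpa [Measure.map_smul, smul_smul, ← h, ENNReal.mul_inv_cancel h0 (measure_ne_top μ univ)]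
    using this

/-- A finite non-atomic measure on `ℝ` has sets of every smaller mass: sublevel sets of its
normalized distribution function. -/
theorem exists_measurableSet_measure_eq (μ : Measure ℝ) [IsFiniteMeasure μ]
    [NullSingletonClass μ] {m : ℝ≥0∞} (hm : m ≤ μ univ) :
    ∃ B, MeasurableSet B ∧ μ B = m := by
  rcases eq_or_ne μ 0 with rfl | hμ
  · exact ⟨∅, .empty, by simpa [eq_comm] using hm⟩
  have h0 : μ univ ≠ 0 := by simpa using hμ
  have ht : μ univ ≠ ∞ := measure_ne_top μ univ
  have hp := isProbabilityMeasure_inv_smul μ hμ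
  have := nullSingletonClass_smul μ (μ univ)⁻¹
  have hle : m / μ univ ≤ 1 := ENNReal.div_le_of_le_mul (by simpa using hm)
  have hB := measure_cdf_le ((μ univ)⁻¹ • μ) (p := (m / μ univ).toReal) ENNReal.toReal_nonneg
    (ENNReal.toReal_le_of_le_ofReal zero_le_one (by simpa using hle))
  rw [ENNReal.ofReal_toReal (hle.trans_lt ENNReal.one_lt_top).ne, Measure.smul_apply, smul_eq_mul,
    ENNReal.div_eq_inv_mul] at hB
  refine ⟨_, ?_, (ENNReal.mul_right_inj (by simp [ht]) (by simpa using h0)).1 hB⟩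
  exact (isClosed_Iic.preimage (continuous_cdf _)).measurableSet

/-! ### Couplings that are almost surely monotone -/

theorem ae_forall_measure_ne_zero {α ι : Type*} [MeasurableSpace α] [Countable ι] (μ : Measure α)
    (s : ι → Set α) : ∀ᵐ x ∂μ, ∀ i, x ∈ s i → μ (s i) ≠ 0 := by
  refine ae_all_iff.2 fun i ↦ ?_
  by_cases h0 : μ (s i) = 0
  · filter_upwards [measure_eq_zero_iff_ae_notMem.1 h0] with x hx h using absurd h hx
  · exact Eventually.of_forall fun _ _ ↦ h0

/-- If no quadrant splitting `(q, q')` has mass on both of its crossing sides, then the plan is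
concentrated on the graph of `Q_ν ∘ F_μ`: almost surely `F_μ(x) ≤ F_ν(y)`, and `F_ν(t) < F_μ(x)` for
all `t < y`. -/
theorem ae_eq_quantile_cdf {γ : Measure (ℝ × ℝ)} [IsProbabilityMeasure γ]
    [NullSingletonClass (γ.map Prod.fst)]
    (h : ∀ q q' : ℝ, γ {p | p.1 < q ∧ q' < p.2} = 0 ∨ γ {p | q < p.1 ∧ p.2 < q'} = 0) :
    ∀ᵐ p ∂γ, p.2 = quantile (γ.map Prod.snd) (cdf (γ.map Prod.fst) p.1) := by
  have : IsProbabilityMeasure (γ.map Prod.fst) :=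
    Measure.isProbabilityMeasure_map measurable_fst.aemeasurable
  have : IsProbabilityMeasure (γ.map Prod.snd) :=
    Measure.isProbabilityMeasure_map measurable_snd.aemeasurable
  set μ := γ.map Prod.fst with hμ
  set ν := γ.map Prod.snd with hν
  have hFμ (q : ℝ) : cdf μ q = γ.real {p | p.1 < q} := by
    rw [cdf_eq_real, measureReal_congr (Iio_ae_eq_Iic (μ := μ)).symm, hμ,
      map_measureReal_apply measurable_fst measurableSet_Iio]
    rfl
  have hFμ' (q : ℝ) : cdf μ q = γ.real {p | p.1 ≤ q} := by
    rw [cdf_eq_real, hμ, map_measureReal_apply measurable_fst measurableSet_Iic]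
    rfl
  have hFν (q : ℝ) : cdf ν q = γ.real {p | p.2 ≤ q} := by
    rw [cdf_eq_real, hν, map_measureReal_apply measurable_snd measurableSet_Iic]
    rfl
  have hU := ae_forall_measure_ne_zero γ
    fun i : ℚ × ℚ ↦ {p : ℝ × ℝ | p.1 < (i.1 : ℝ) ∧ (i.2 : ℝ) < p.2}
  have hV := ae_forall_measure_ne_zero γ
    fun i : ℚ × ℚ ↦ {p : ℝ × ℝ | (i.1 : ℝ) < p.1 ∧ p.2 < (i.2 : ℝ)}
  -- `F_μ(x)` almost surely avoids the countably many values `F_ν(t)`, `t` rational, and thereby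
  -- every level at which `F_ν` is flat; this makes the inequality for `t < y` strict
  have hflat : ∀ᵐ p ∂γ, ∀ t : ℚ, cdf μ p.1 ≠ cdf ν t := by
    rw [ae_all_iff]
    intro t
    exact ae_of_ae_map measurable_fst.aemeasurable
      (measure_eq_zero_iff_ae_notMem.1 (measure_cdf_eq_const μ (cdf ν t)))
  filter_upwards [hU, hV, hflat] with ⟨x, y⟩ hU hV hflat
  simp only at hflat ⊢
  have hlow : cdf μ x ≤ cdf ν y := by
    have hright : ∀ q : ℚ, (q : ℝ) < x → cdf μ q ≤ cdf ν y := by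
      intro q hq
      have : Nonempty {r : ℚ // y < r} := nonempty_subtype.2 (exists_rat_gt y)
      rw [← (cdf ν).iInf_rat_gt_eq y]
      refine le_ciInf fun ⟨q', hq'⟩ ↦ ?_
      have h0 := (h q q').resolve_right (hV (q, q') ⟨hq, hq'⟩)
      rw [hFμ, hFν]
      refine ENNReal.toReal_mono (measure_ne_top _ _) ?_
      calc γ {p | p.1 < (q : ℝ)}
          ≤ γ ({p | p.2 ≤ (q' : ℝ)} ∪ {p | p.1 < (q : ℝ) ∧ (q' : ℝ) < p.2}) :=
            measure_mono fun p hp ↦ (le_or_gt p.2 q').imp id fun h ↦ ⟨hp, h⟩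
        _ ≤ γ {p | p.2 ≤ (q' : ℝ)} := by
            simpa [h0] using measure_union_le (μ := γ) {p | p.2 ≤ (q' : ℝ)}
              {p | p.1 < (q : ℝ) ∧ (q' : ℝ) < p.2}
    -- `F_μ` is left-continuous at `x`
    by_contra! hlt
    obtain ⟨z, hz, hzx⟩ := mem_nhdsLT_iff_exists_Ioo_subset.1
      (((continuous_cdf μ).continuousWithinAt (s := Iio x)).preimage_mem_nhdsWithin
        (Ioi_mem_nhds hlt))
    obtain ⟨q, hzq, hqx⟩ := exists_rat_btwn (mem_Iio.1 hz)
    exact absurd (hright q hqx) (not_le.2 (hzx ⟨hzq, hqx⟩))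
  have hup : ∀ t < y, cdf ν t < cdf μ x := by
    have hle : ∀ t : ℚ, (t : ℝ) < y → cdf ν t ≤ cdf μ x := by
      intro t ht
      obtain ⟨q', htq', hq'y⟩ := exists_rat_btwn ht
      have : Nonempty {r : ℚ // x < r} := nonempty_subtype.2 (exists_rat_gt x)
      rw [← (cdf μ).iInf_rat_gt_eq x]
      refine le_ciInf fun ⟨q, hq⟩ ↦ ?_
      have h0 := (h q q').resolve_left (hU (q, q') ⟨hq, hq'y⟩)
      rw [hFμ', hFν]
      refine ENNReal.toReal_mono (measure_ne_top _ _) ?_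
      calc γ {p | p.2 ≤ (t : ℝ)}
          ≤ γ ({p | p.1 ≤ (q : ℝ)} ∪ {p | (q : ℝ) < p.1 ∧ p.2 < (q' : ℝ)}) :=
            measure_mono fun p hp ↦ (le_or_gt p.1 q).imp id fun h ↦
              ⟨h, lt_of_le_of_lt hp htq'⟩
        _ ≤ γ {p | p.1 ≤ (q : ℝ)} := by
            simpa [h0] using measure_union_le (μ := γ) {p | p.1 ≤ (q : ℝ)}
              {p | (q : ℝ) < p.1 ∧ p.2 < (q' : ℝ)}
    intro t ht
    obtain ⟨q', htq', hq'y⟩ := exists_rat_btwn ht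
    exact (monotone_cdf ν htq'.le).trans_lt (lt_of_le_of_ne (hle q' hq'y) (hflat q').symm)
  -- the infimum defining the quantile is attained, so it is not a junk value
  have : IsLeast {t : ℝ | cdf μ x ≤ cdf ν t} y :=
    ⟨hlow, fun t ht ↦ not_lt.1 fun hty ↦ absurd ht (not_le.2 (hup t hty))⟩
  exact this.csInf_eq.symm

/-! ### Strictly submodular costs and the rearrangement of crossing mass -/

/-- The inequality integrates the sign of the mixed partial derivative, first in `x` and then
in `y`. -/
theorem strictSubmodular_of_mixedPartial_neg {c : ℝ → ℝ → ℝ} (hc : TwiceDifferentiable c)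
    (hneg : ∀ x y, mixedPartial c x y < 0) {x x' y y' : ℝ} (hx : x < x') (hy : y < y') :
    c x y + c x' y' < c x y' + c x' y := by
  have hd (u : ℝ) : Differentiable ℝ (c u) :=
    hc.1.comp (f := fun v : ℝ ↦ (u, v)) ((differentiable_const u).prodMk differentiable_id)
  have hpartial (v : ℝ) : StrictAnti fun u ↦ deriv (c u) v :=
    strictAnti_of_deriv_neg fun u ↦ hneg u v
  have hdiff : StrictAnti fun v ↦ c x' v - c x v := by
    refine strictAnti_of_deriv_neg fun v ↦ ?_
    rw [deriv_fun_sub (hd x' v) (hd x v)]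
    linarith [hpartial v hx]
  linarith [hdiff hy]

theorem nullSingletonClass_map_restrict {α : Type*} [MeasurableSpace α] (γ : Measure α)
    {g : α → ℝ} (hg : Measurable g) [NullSingletonClass (γ.map g)] (A : Set α) :
    NullSingletonClass ((γ.restrict A).map g) :=
  ⟨fun x ↦ le_antisymm ((Measure.map_mono Measure.restrict_le_self hg {x}).trans_eq
    (measure_singleton x)) zero_le⟩

theorem exists_measurableSet_subset_measure_eq {α : Type*} [MeasurableSpace α]
    (γ : Measure α) [IsFiniteMeasure γ] {g : α → ℝ} (hg : Measurable g)
    [NullSingletonClass (γ.map g)] {A : Set α} (hA : MeasurableSet A) {m : ℝ≥0∞} (hm : m ≤ γ A) :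
    ∃ A' ⊆ A, MeasurableSet A' ∧ γ A' = m := by
  have := nullSingletonClass_map_restrict γ hg A
  obtain ⟨B, hB, hBm⟩ := exists_measurableSet_measure_eq ((γ.restrict A).map g) (m := m)
    (by simpa [Measure.map_apply hg .univ] using hm)
  rw [Measure.map_apply hg hB, Measure.restrict_apply (hg hB)] at hBm
  exact ⟨g ⁻¹' B ∩ A, inter_subset_right, (hg hB).inter hA, hBm⟩

/-- If a plan puts mass both on the quadrant left of `q` and above `q'` and on the quadrant right
of `q` and below `q'`, then exchanging the second marginals of two pieces of equal mass in these
quadrants lowers the cost. The first marginal being non-atomic, the new second coordinate can be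
chosen as a function `G` of the old pair. -/
theorem exists_rearrangement_lintegral_lt (γ : Measure (ℝ × ℝ)) [IsFiniteMeasure γ]
    [NullSingletonClass (γ.map Prod.fst)] {k : ℝ → ℝ → ℝ≥0∞}
    (hk : Measurable fun p : ℝ × ℝ ↦ k p.1 p.2) (hk_ne_top : ∀ x y, k x y ≠ ∞)
    (hsub : ∀ {x x' y y' : ℝ}, x < x' → y < y' → k x y + k x' y' < k x y' + k x' y)
    (hcost : ∫⁻ p, k p.1 p.2 ∂γ ≠ ∞) {q q' : ℝ}
    (hU : γ {p | p.1 < q ∧ q' < p.2} ≠ 0) (hV : γ {p | q < p.1 ∧ p.2 < q'} ≠ 0) :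
    ∃ G : ℝ × ℝ → ℝ, Measurable G ∧ γ.map G = γ.map Prod.snd ∧
      ∫⁻ p, k p.1 (G p) ∂γ < ∫⁻ p, k p.1 p.2 ∂γ := by
  set m := min (γ {p | p.1 < q ∧ q' < p.2}) (γ {p | q < p.1 ∧ p.2 < q'}) with hm
  have hm0 : m ≠ 0 := by
    rcases min_choice (γ {p | p.1 < q ∧ q' < p.2}) (γ {p | q < p.1 ∧ p.2 < q'}) with h | h <;>
      rw [hm, h] <;> assumption
  have hkx : Measurable fun p : ℝ × ℝ ↦ k p.1 q' :=
    hk.comp (measurable_fst.prodMk measurable_const)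
  have hky : Measurable fun y ↦ k q y := hk.comp (measurable_const.prodMk measurable_id)
  obtain ⟨U, hUsub, hUmeas, hUm : γ U = m⟩ :=
    exists_measurableSet_subset_measure_eq γ measurable_fst
      ((measurableSet_lt measurable_fst measurable_const).inter
        (measurableSet_lt measurable_const measurable_snd)) (min_le_left _ _ : m ≤ _)
  obtain ⟨V, hVsub, hVmeas, hVm : γ V = m⟩ :=
    exists_measurableSet_subset_measure_eq γ measurable_fst
      ((measurableSet_lt measurable_const measurable_fst).inter
        (measurableSet_lt measurable_snd measurable_const)) (min_le_right _ _ : m ≤ _)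
  replace hUsub : U ⊆ {p | p.1 < q ∧ q' < p.2} := hUsub
  replace hVsub : V ⊆ {p | q < p.1 ∧ p.2 < q'} := hVsub
  have hUV : Disjoint U V :=
    Set.disjoint_left.2 fun p hp hp' ↦ lt_asymm (hUsub hp).1 (hVsub hp').1
  have := nullSingletonClass_map_restrict γ measurable_fst U
  have := nullSingletonClass_map_restrict γ measurable_fst V
  -- on `U`, use the second marginal of `V`, and conversely
  obtain ⟨T, hT, hTlaw⟩ := exists_measurable_map_eq ((γ.restrict U).map Prod.fst)
    ((γ.restrict V).map Prod.snd) (by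
      simp [Measure.map_apply measurable_fst, Measure.map_apply measurable_snd, hUm, hVm])
  obtain ⟨R, hR, hRlaw⟩ := exists_measurable_map_eq ((γ.restrict V).map Prod.fst)
    ((γ.restrict U).map Prod.snd) (by
      simp [Measure.map_apply measurable_fst, Measure.map_apply measurable_snd, hUm, hVm])
  rw [Measure.map_map hT measurable_fst] at hTlaw
  rw [Measure.map_map hR measurable_fst] at hRlaw
  have hsplit : γ = γ.restrict U + γ.restrict V + γ.restrict (U ∪ V)ᶜ := by
    rw [← Measure.restrict_union hUV hVmeas, Measure.restrict_add_restrict_compl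
      (hUmeas.union hVmeas)]
  classical
  set G : ℝ × ℝ → ℝ := U.piecewise (T ∘ Prod.fst) (V.piecewise (R ∘ Prod.fst) Prod.snd) with hGdef
  have hG : Measurable G :=
    (hT.comp measurable_fst).piecewise hUmeas ((hR.comp measurable_fst).piecewise hVmeas
      measurable_snd)
  have hGU : G =ᵐ[γ.restrict U] T ∘ Prod.fst :=
    ae_restrict_of_forall_mem hUmeas fun p hp ↦ by simp [hGdef, hp]
  have hGV : G =ᵐ[γ.restrict V] R ∘ Prod.fst :=
    ae_restrict_of_forall_mem hVmeas fun p hp ↦ by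
      simp [hGdef, hp, Set.disjoint_right.1 hUV hp]
  have hGW : G =ᵐ[γ.restrict (U ∪ V)ᶜ] Prod.snd :=
    ae_restrict_of_forall_mem (hUmeas.union hVmeas).compl fun p hp ↦ by
      simp only [mem_compl_iff, mem_union, not_or] at hp
      simp [hGdef, hp.1, hp.2]
  refine ⟨G, hG, ?_, ?_⟩
  · calc γ.map G = (γ.restrict U).map G + (γ.restrict V).map G + (γ.restrict (U ∪ V)ᶜ).map G := by
          conv_lhs => rw [hsplit]
          rw [Measure.map_add _ _ hG, Measure.map_add _ _ hG]
      _ = (γ.restrict U).map Prod.snd + (γ.restrict V).map Prod.snd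
            + (γ.restrict (U ∪ V)ᶜ).map Prod.snd := by
          rw [Measure.map_congr hGU, Measure.map_congr hGV, Measure.map_congr hGW, hTlaw, hRlaw,
            add_comm ((γ.restrict V).map Prod.snd)]
      _ = γ.map Prod.snd := by
          conv_rhs => rw [hsplit]
          rw [Measure.map_add _ _ measurable_snd, Measure.map_add _ _ measurable_snd]
  have hle (A : Set (ℝ × ℝ)) : ∫⁻ p in A, k p.1 p.2 ∂γ ≠ ∞ :=
    ((setLIntegral_le_lintegral _ _).trans_lt hcost.lt_top).ne
  have hmk : m * k q q' ≠ ∞ :=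
    ENNReal.mul_ne_top (hUm ▸ measure_ne_top γ U) (hk_ne_top q q')
  -- `k(x, q') + k(q, y) - k(q, q')` has the same total integral over the two pieces before and
  -- after the exchange; on the original pairs it is smaller than `k(x, y)`, finiteness of the
  -- smaller side being inherited from the larger one
  have hold : ∀ A : Set (ℝ × ℝ), MeasurableSet A → γ A = m →
      (∀ p ∈ A, k p.1 q' + k q p.2 < k p.1 p.2 + k q q') →
      ∫⁻ p in A, k p.1 q' ∂γ + ∫⁻ p in A, k q p.2 ∂γ < ∫⁻ p in A, k p.1 p.2 ∂γ + m * k q q' := by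
    intro A hA hAm hlt
    have hright : ∫⁻ p in A, (k p.1 p.2 + k q q') ∂γ = ∫⁻ p in A, k p.1 p.2 ∂γ + m * k q q' := by
      rw [lintegral_add_right _ measurable_const, setLIntegral_const, hAm, mul_comm]
    rw [← lintegral_add_left hkx, ← hright]
    refine setLIntegral_strict_mono hA (hAm ▸ hm0) (hk.add_const _) ?_ (ae_of_all _ hlt)
    refine ((setLIntegral_mono' hA fun p hp ↦ (hlt p hp).le).trans_lt ?_).ne
    rw [hright]
    exact (ENNReal.add_ne_top.2 ⟨hle A, hmk⟩).lt_top
  -- on the rearranged pairs it is at least `k(x, y)`; all in additive form, `ℝ≥0∞` having no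
  -- cancellative subtraction
  have hnew : ∀ (A B : Set (ℝ × ℝ)) (τ : ℝ → ℝ), MeasurableSet A → Measurable τ → γ A = m →
      (γ.restrict A).map (τ ∘ Prod.fst) = (γ.restrict B).map Prod.snd →
      (∀ᵐ p ∂(γ.restrict A), k p.1 (τ p.1) + k q q' ≤ k p.1 q' + k q (τ p.1)) →
      ∫⁻ p in A, k p.1 (τ p.1) ∂γ + m * k q q' ≤
        ∫⁻ p in A, k p.1 q' ∂γ + ∫⁻ p in B, k q p.2 ∂γ := by
    intro A B τ hA hτ hAm hlaw hineq
    have hswap : ∫⁻ p in A, k q (τ p.1) ∂γ = ∫⁻ p in B, k q p.2 ∂γ := by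
      rw [← lintegral_map hky measurable_snd, ← hlaw,
        lintegral_map hky (hτ.comp measurable_fst)]
      rfl
    calc ∫⁻ p in A, k p.1 (τ p.1) ∂γ + m * k q q'
        = ∫⁻ p in A, (k p.1 (τ p.1) + k q q') ∂γ := by
          rw [lintegral_add_right _ measurable_const, setLIntegral_const, hAm, mul_comm]
      _ ≤ ∫⁻ p in A, (k p.1 q' + k q (τ p.1)) ∂γ := lintegral_mono_ae hineq
      _ = _ := by rw [lintegral_add_left hkx, hswap]
  have hoU := hold U hUmeas hUm fun p hp ↦ by
    simpa [add_comm] using hsub (hUsub hp).1 (hUsub hp).2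
  have hoV := hold V hVmeas hVm fun p hp ↦ by
    simpa [add_comm] using hsub (hVsub hp).1 (hVsub hp).2
  have hTlt : ∀ᵐ p ∂(γ.restrict U), T p.1 < q' := by
    refine ae_of_ae_map (f := T ∘ Prod.fst) (p := fun y ↦ y < q')
      (hT.comp measurable_fst).aemeasurable ?_
    rw [hTlaw, ae_map_iff measurable_snd.aemeasurable measurableSet_Iio]
    exact ae_restrict_of_forall_mem hVmeas fun p hp ↦ (hVsub hp).2
  have hRlt : ∀ᵐ p ∂(γ.restrict V), q' < R p.1 := by
    refine ae_of_ae_map (f := R ∘ Prod.fst) (p := fun y ↦ q' < y)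
      (hR.comp measurable_fst).aemeasurable ?_
    rw [hRlaw, ae_map_iff measurable_snd.aemeasurable measurableSet_Ioi]
    exact ae_restrict_of_forall_mem hUmeas fun p hp ↦ (hUsub hp).2
  have hnU := hnew U V T hUmeas hT hUm hTlaw (by
    filter_upwards [hTlt, ae_restrict_mem hUmeas] with p hp hpU
    exact (hsub (hUsub hpU).1 hp).le)
  have hnV := hnew V U R hVmeas hR hVm hRlaw (by
    filter_upwards [hRlt, ae_restrict_mem hVmeas] with p hp hpV
    simpa [add_comm] using (hsub (hVsub hpV).1 hp).le)
  have hcells : ∫⁻ p in U, k p.1 (T p.1) ∂γ + ∫⁻ p in V, k p.1 (R p.1) ∂γ <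
      ∫⁻ p in U, k p.1 p.2 ∂γ + ∫⁻ p in V, k p.1 p.2 ∂γ := by
    refine (ENNReal.add_lt_add_iff_right (ENNReal.add_ne_top.2 ⟨hmk, hmk⟩)).1 ?_
    calc ∫⁻ p in U, k p.1 (T p.1) ∂γ + ∫⁻ p in V, k p.1 (R p.1) ∂γ + (m * k q q' + m * k q q')
        = (∫⁻ p in U, k p.1 (T p.1) ∂γ + m * k q q')
            + (∫⁻ p in V, k p.1 (R p.1) ∂γ + m * k q q') := by ring
      _ ≤ (∫⁻ p in U, k p.1 q' ∂γ + ∫⁻ p in V, k q p.2 ∂γ)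
            + (∫⁻ p in V, k p.1 q' ∂γ + ∫⁻ p in U, k q p.2 ∂γ) := add_le_add hnU hnV
      _ = (∫⁻ p in U, k p.1 q' ∂γ + ∫⁻ p in U, k q p.2 ∂γ)
            + (∫⁻ p in V, k p.1 q' ∂γ + ∫⁻ p in V, k q p.2 ∂γ) := by ring
      _ < (∫⁻ p in U, k p.1 p.2 ∂γ + m * k q q')
            + (∫⁻ p in V, k p.1 p.2 ∂γ + m * k q q') := ENNReal.add_lt_add hoU hoV
      _ = _ := by ring
  calc ∫⁻ p, k p.1 (G p) ∂γ
      = ∫⁻ p in U, k p.1 (T p.1) ∂γ + ∫⁻ p in V, k p.1 (R p.1) ∂γ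
          + ∫⁻ p in (U ∪ V)ᶜ, k p.1 p.2 ∂γ := by
        conv_lhs => rw [hsplit]
        rw [lintegral_add_measure, lintegral_add_measure,
          lintegral_congr_ae (hGU.mono fun p hp ↦ by simp only [hp, Function.comp_apply]; rfl),
          lintegral_congr_ae (hGV.mono fun p hp ↦ by simp only [hp, Function.comp_apply]; rfl),
          lintegral_congr_ae (hGW.mono fun p hp ↦ by simp only [hp]; rfl)]
    _ < ∫⁻ p in U, k p.1 p.2 ∂γ + ∫⁻ p in V, k p.1 p.2 ∂γ
          + ∫⁻ p in (U ∪ V)ᶜ, k p.1 p.2 ∂γ :=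
        (ENNReal.add_lt_add_iff_right (hle _)).2 hcells
    _ = ∫⁻ p, k p.1 p.2 ∂γ := by
        conv_rhs => rw [hsplit]
        rw [lintegral_add_measure, lintegral_add_measure]

/-- A plan with non-atomic first marginal and finite cost either is almost surely the quantile
coupling of its marginals, or is strictly improved by changing its second coordinate to a function
of the pair with the same law. -/
theorem ae_eq_quantile_cdf_or_exists_planCost_lt {c : ℝ → ℝ → ℝ} (hc : TwiceDifferentiable c)
    (hneg : ∀ x y, mixedPartial c x y < 0) (hnonneg : ∀ x y, 0 ≤ c x y)
    (γ : Measure (ℝ × ℝ)) [IsProbabilityMeasure γ] [NullSingletonClass (γ.map Prod.fst)]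
    (hcost : planCost c γ ≠ ∞) :
    (∀ᵐ p ∂γ, p.2 = quantile (γ.map Prod.snd) (cdf (γ.map Prod.fst) p.1)) ∨
    ∃ G : ℝ × ℝ → ℝ, Measurable G ∧ γ.map G = γ.map Prod.snd ∧
      ∫⁻ p, ENNReal.ofReal (c p.1 (G p)) ∂γ < planCost c γ := by
  by_cases h : ∀ q q' : ℝ, γ {p | p.1 < q ∧ q' < p.2} = 0 ∨ γ {p | q < p.1 ∧ p.2 < q'} = 0
  · exact Or.inl (ae_eq_quantile_cdf h)
  push Not at h
  obtain ⟨q, q', hU, hV⟩ := h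
  refine Or.inr (exists_rearrangement_lintegral_lt γ (k := fun x y ↦ ENNReal.ofReal (c x y))
    hc.1.continuous.measurable.ennreal_ofReal (fun _ _ ↦ ENNReal.ofReal_ne_top) ?_ hcost hU hV)
  intro x x' y y' hx hy
  rw [← ENNReal.ofReal_add (hnonneg _ _) (hnonneg _ _),
    ← ENNReal.ofReal_add (hnonneg _ _) (hnonneg _ _)]
  have hlt := strictSubmodular_of_mixedPartial_neg hc hneg hx hy
  exact (ENNReal.ofReal_lt_ofReal_iff
    ((add_nonneg (hnonneg _ _) (hnonneg _ _)).trans_lt hlt)).2 hlt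

/-- The improvement of a map plan is again a plan between the same marginals, though no longer one
given by a map, so an optimal map admits none. -/
theorem optimalTransportMap_ae_eq_quantile_cdf {c : ℝ → ℝ → ℝ} (hc : TwiceDifferentiable c)
    (hneg : ∀ x y, mixedPartial c x y < 0) (hnonneg : ∀ x y, 0 ≤ c x y) {μ ν : Measure ℝ}
    [IsProbabilityMeasure μ] [NullSingletonClass μ] {T : ℝ → ℝ}
    (hT : IsOptimalTransportMap c μ ν T) (hcost : kantorovichCost c μ ν ≠ ∞) :
    ∀ᵐ x ∂μ, T x = quantile ν (cdf μ x) := by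
  obtain ⟨hTm, hTν, hopt⟩ := hT
  have hpair : Measurable fun x ↦ (x, T x) := measurable_id.prodMk hTm
  set γ := μ.map fun x ↦ (x, T x) with hγ
  have : IsProbabilityMeasure γ := Measure.isProbabilityMeasure_map hpair.aemeasurable
  have hfst : γ.map Prod.fst = μ := by
    rw [hγ, Measure.map_map measurable_fst hpair]; exact Measure.map_id
  have hsnd : γ.map Prod.snd = ν := by
    rw [hγ, Measure.map_map measurable_snd hpair]; exact hTν
  have : NullSingletonClass (γ.map Prod.fst) := hfst ▸ ‹_›
  rcases ae_eq_quantile_cdf_or_exists_planCost_lt hc hneg hnonneg γ (hopt ▸ hcost) with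
    h | ⟨G, hG, hGlaw, hlt⟩
  · rw [hfst, hsnd] at h
    exact ae_of_ae_map hpair.aemeasurable h
  have hpairG : Measurable fun p : ℝ × ℝ ↦ (p.1, G p) := measurable_fst.prodMk hG
  have hle : kantorovichCost c μ ν ≤ planCost c (γ.map fun p ↦ (p.1, G p)) := by
    refine iInf₂_le _ ⟨?_, ?_⟩
    · rw [Measure.map_map measurable_fst hpairG]; exact hfst
    · rw [Measure.map_map measurable_snd hpairG]; exact hGlaw.trans hsnd
  rw [planCost, lintegral_map hc.1.continuous.measurable.ennreal_ofReal hpairG] at hle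
  exact absurd (hopt ▸ hlt) (not_lt.2 hle)

/-! ### The risk as a transport cost -/

section Risk

variable {Ω E : Type*} [MeasurableSpace Ω] [MeasurableSpace E]

/-- For conditionally independent events, conditioning on the second one can be undone: the first
one only enters through its conditional probability. -/
theorem measureReal_inter_eq_setIntegral_condExp {Ω : Type*} {m mΩ : MeasurableSpace Ω}
    {P : Measure Ω} [IsFiniteMeasure P] (hm : m ≤ mΩ) {A B : Set Ω} (hA : MeasurableSet A)
    (hB : MeasurableSet B) (h : P⟦A ∩ B | m⟧ =ᵐ[P] fun ω ↦ (P⟦A | m⟧) ω * (P⟦B | m⟧) ω) :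
    P.real (A ∩ B) = ∫ ω in B, (P⟦A | m⟧) ω ∂P := by
  have hmul : P⟦A | m⟧ * B.indicator (fun _ ↦ (1 : ℝ)) = B.indicator (P⟦A | m⟧) := by
    ext ω; by_cases h : ω ∈ B <;> simp [h]
  have hpull := condExp_mul_of_stronglyMeasurable_left
    (stronglyMeasurable_condExp (m := m) (μ := P) (f := A.indicator fun _ ↦ (1 : ℝ)))
    (hmul ▸ integrable_condExp.indicator hB) ((integrable_const (1 : ℝ)).indicator hB)
  calc P.real (A ∩ B)
      = ∫ ω, (A ∩ B).indicator (fun _ ↦ (1 : ℝ)) ω ∂P := by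
        rw [integral_indicator_const _ (hA.inter hB)]; simp
    _ = ∫ ω, (P⟦A ∩ B | m⟧) ω ∂P := (integral_condExp hm).symm
    _ = ∫ ω, (P[P⟦A | m⟧ * B.indicator (fun _ ↦ (1 : ℝ)) | m]) ω ∂P :=
        integral_congr_ae (h.trans hpull.symm)
    _ = ∫ ω, B.indicator (P⟦A | m⟧) ω ∂P := by rw [integral_condExp hm, hmul]
    _ = _ := integral_indicator hB

/-- If `Y` depends on `W` only through `φ(W)`, then the conditional distribution of `Y` given
`φ(W)` is also the conditional distribution of `Y` given `W`. -/
theorem map_prodMk_eq_compProd_comap {P : Measure Ω} [IsProbabilityMeasure P] {W : Ω → E}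
    {Y : Ω → ℝ} (hW : Measurable W) (hY : Measurable Y) {φ : E → ℝ} (hφ : Measurable φ)
    (hindep : CondIndepGiven P Y W fun ω ↦ φ (W ω)) {F : Kernel ℝ ℝ} [IsMarkovKernel F]
    (hF : HasCondDistrib Y (fun ω ↦ φ (W ω)) F P) :
    P.map (fun ω ↦ (W ω, Y ω)) = P.map W ⊗ₘ F.comap φ hφ := by
  have hZ : Measurable fun ω ↦ φ (W ω) := hφ.comp hW
  have : IsProbabilityMeasure (P.map fun ω ↦ (W ω, Y ω)) :=
    Measure.isProbabilityMeasure_map (hW.prodMk hY).aemeasurable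
  refine Measure.ext_prod fun {B A} hB hA ↦ ?_
  have hFA : P⟦Y ⁻¹' A | MeasurableSpace.comap (fun ω ↦ φ (W ω)) inferInstance⟧ =ᵐ[P]
      fun ω ↦ (F (φ (W ω))).real A := by
    have h := condDistrib_ae_eq_of_measure_eq_compProd (fun ω ↦ φ (W ω)) hY.aemeasurable hF.map_eq
    filter_upwards [condDistrib_ae_eq_condExp (μ := P) hZ hY hA,
      ae_of_ae_map hZ.aemeasurable h] with ω h1 h2
    rw [← h1, h2]
  have hreal : P.real (Y ⁻¹' A ∩ W ⁻¹' B) = ∫ ω in W ⁻¹' B, (F (φ (W ω))).real A ∂P :=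
    (measureReal_inter_eq_setIntegral_condExp hZ.comap_le (hY hA) (hW hB)
      (hindep A B hA hB)).trans (integral_congr_ae (ae_restrict_of_ae hFA))
  have hFmeas : Measurable fun ω ↦ F (φ (W ω)) A := (F.measurable_coe hA).comp hZ
  rw [Measure.compProd_apply_prod hB hA,
    setLIntegral_map hB ((F.comap φ hφ).measurable_coe hA) hW,
    Measure.map_apply (hW.prodMk hY) (hB.prod hA)]
  have hset : (fun ω ↦ (W ω, Y ω)) ⁻¹' B ×ˢ A = Y ⁻¹' A ∩ W ⁻¹' B := by
    ext ω; simp [and_comm]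
  rw [hset, ← ofReal_measureReal, hreal]
  simp only [Kernel.comap_apply, measureReal_def]
  rw [integral_toReal hFmeas.aemeasurable (ae_of_all _ fun ω ↦ measure_lt_top _ _),
    ENNReal.ofReal_toReal]
  exact ((lintegral_mono fun ω ↦ prob_le_one).trans_lt (by simp)).ne

theorem inducedCost_nonneg (L : ℝ → ℝ → ℝ≥0) (F : Kernel ℝ ℝ) (x y : ℝ) :
    0 ≤ inducedCost L F x y :=
  integral_nonneg fun _ ↦ NNReal.coe_nonneg _

theorem ofReal_inducedCost {L : ℝ → ℝ → ℝ≥0} {F : Kernel ℝ ℝ} {x y : ℝ}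
    (h : Integrable (fun t ↦ (L y t : ℝ)) (F x)) :
    ENNReal.ofReal (inducedCost L F x y) = ∫⁻ t, (L y t : ℝ≥0∞) ∂(F x) := by
  rw [inducedCost, ofReal_integral_eq_lintegral_ofReal h (ae_of_all _ fun _ ↦ NNReal.coe_nonneg _)]
  simp

/-- The risk is the integral of the induced cost: `Y` can be integrated out conditionally on
`(X, S)`, whose effect on `Y` passes through `φ(X, S)`. -/
theorem risk_eq_lintegral_inducedCost {P : Measure Ω} [IsProbabilityMeasure P] {X : Ω → E}
    {S : Ω → Fin 2} {Y : Ω → ℝ} (hX : Measurable X) (hS : Measurable S) (hY : Measurable Y)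
    {L : ℝ → ℝ → ℝ≥0} (hL : Measurable fun p : ℝ × ℝ ↦ L p.1 p.2)
    {φ : E × Fin 2 → ℝ} (hφ : Measurable φ)
    (hindep : CondIndepGiven P Y (fun ω ↦ (X ω, S ω)) fun ω ↦ φ (X ω, S ω))
    {F : Kernel ℝ ℝ} [IsMarkovKernel F]
    (hF : HasCondDistrib Y (fun ω ↦ φ (X ω, S ω)) F P)
    (hC : ∀ x y : ℝ, Integrable (fun t ↦ (L y t : ℝ)) (F x))
    {g : E × Fin 2 → ℝ} (hg : Measurable g) :
    risk P X S Y L g =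
      ∫⁻ ω, ENNReal.ofReal (inducedCost L F (φ (X ω, S ω)) (g (X ω, S ω))) ∂P := by
  have hW : Measurable fun ω ↦ (X ω, S ω) := hX.prodMk hS
  have hLg : Measurable fun p : (E × Fin 2) × ℝ ↦ (L (g p.1) p.2 : ℝ≥0∞) :=
    (hL.comp ((hg.comp measurable_fst).prodMk measurable_snd)).coe_nnreal_ennreal
  calc risk P X S Y L g
      = ∫⁻ p, (L (g p.1) p.2 : ℝ≥0∞) ∂(P.map fun ω ↦ ((X ω, S ω), Y ω)) :=
        (lintegral_map hLg (hW.prodMk hY)).symm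
    _ = ∫⁻ w, ∫⁻ t, (L (g w) t : ℝ≥0∞) ∂(F.comap φ hφ w) ∂(P.map fun ω ↦ (X ω, S ω)) := by
        rw [map_prodMk_eq_compProd_comap hW hY hφ hindep hF, Measure.lintegral_compProd hLg]
    _ = ∫⁻ ω, ∫⁻ t, (L (g (X ω, S ω)) t : ℝ≥0∞) ∂(F (φ (X ω, S ω))) ∂P :=
        lintegral_map hLg.lintegral_kernel_prod_right' hW
    _ = _ := lintegral_congr fun ω ↦ (ofReal_inducedCost (hC _ _)).symm

/-! ### Changing a prediction function on one group -/

theorem lintegral_fin_two_eq_add_cond {P : Measure Ω} [IsFiniteMeasure P] {S : Ω → Fin 2}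
    (hS : Measurable S) (hr : ∀ s, P (S ⁻¹' {s}) ≠ 0) (h : Ω → ℝ≥0∞) :
    ∫⁻ ω, h ω ∂P = ∑ s, P (S ⁻¹' {s}) * ∫⁻ ω, h ω ∂(P[|S ⁻¹' {s}]) := by
  have hsum (s : Fin 2) : P (S ⁻¹' {s}) * ∫⁻ ω, h ω ∂(P[|S ⁻¹' {s}]) =
      ∫⁻ ω in S ⁻¹' {s}, h ω ∂P := by
    rw [ProbabilityTheory.cond, lintegral_smul_measure, smul_eq_mul, ← mul_assoc,
      ENNReal.mul_inv_cancel (hr s) (measure_ne_top _ _), one_mul]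
  have hcompl : (S ⁻¹' {0})ᶜ = S ⁻¹' {1} := by
    ext ω; simp only [mem_compl_iff, mem_preimage, mem_singleton_iff]; omega
  rw [Fin.sum_univ_two, hsum, hsum, ← hcompl,
    lintegral_add_compl _ (hS (measurableSet_singleton 0))]

/-- The joint law of the values of `φ` and `f` in group `s`. -/
noncomputable def groupPlan (P : Measure Ω) (X : Ω → E) (S : Ω → Fin 2) (φ f : E × Fin 2 → ℝ)
    (s : Fin 2) : Measure (ℝ × ℝ) :=
  (P[|S ⁻¹' {s}]).map fun ω ↦ (φ (X ω, s), f (X ω, s))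

theorem lintegral_eq_sum_lintegral_groupPlan {P : Measure Ω} [IsFiniteMeasure P] {X : Ω → E}
    {S : Ω → Fin 2} (hX : Measurable X) (hS : Measurable S) (hr : ∀ s, P (S ⁻¹' {s}) ≠ 0)
    {φ f : E × Fin 2 → ℝ} (hφ : Measurable φ) (hf : Measurable f) {k : ℝ → ℝ → ℝ≥0∞}
    (hk : Measurable fun p : ℝ × ℝ ↦ k p.1 p.2) :
    ∫⁻ ω, k (φ (X ω, S ω)) (f (X ω, S ω)) ∂P =
      ∑ s, P (S ⁻¹' {s}) * ∫⁻ p, k p.1 p.2 ∂(groupPlan P X S φ f s) := by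
  rw [lintegral_fin_two_eq_add_cond hS hr]
  refine Finset.sum_congr rfl fun s _ ↦ ?_
  have hXs : Measurable fun ω ↦ (X ω, s) := hX.prodMk measurable_const
  have hpair : Measurable fun ω ↦ (φ (X ω, s), f (X ω, s)) :=
    (hφ.comp hXs).prodMk (hf.comp hXs)
  rw [groupPlan, lintegral_map hk hpair]
  congr 1
  refine lintegral_congr_ae ?_
  filter_upwards [ae_cond_mem (hS (measurableSet_singleton s))] with ω hω
  rw [show S ω = s from hω]

/-- In each group, a fair risk minimizer is the quantile coupling of `φ` with its own law. Otherwise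
its coupling with `φ` could be improved; as the improved second coordinate is a function of the old
pair, it is realized by a prediction function, which is fair because the law in the group is
kept. -/
theorem IsFairRiskMinimizer.ae_eq_quantile_cdf {P : Measure Ω} [IsProbabilityMeasure P]
    {X : Ω → E} {S : Ω → Fin 2} {Y : Ω → ℝ} (hX : Measurable X) (hS : Measurable S)
    (hY : Measurable Y) (hr : ∀ s, P (S ⁻¹' {s}) ≠ 0)
    {L : ℝ → ℝ → ℝ≥0} (hL : Measurable fun p : ℝ × ℝ ↦ L p.1 p.2)
    {φ : E × Fin 2 → ℝ} (hφ : Measurable φ)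
    (hindep : CondIndepGiven P Y (fun ω ↦ (X ω, S ω)) fun ω ↦ φ (X ω, S ω))
    {F : Kernel ℝ ℝ} [IsMarkovKernel F]
    (hF : HasCondDistrib Y (fun ω ↦ φ (X ω, S ω)) F P)
    (hC : ∀ x y : ℝ, Integrable (fun t ↦ (L y t : ℝ)) (F x))
    (hdiff : TwiceDifferentiable (inducedCost L F))
    (hneg : ∀ x y : ℝ, mixedPartial (inducedCost L F) x y < 0)
    (hatom : ∀ s, NullSingletonClass (groupLaw P X S φ s))
    {f : E × Fin 2 → ℝ} (hf : IsFairRiskMinimizer P X S Y L f)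
    (hfin : risk P X S Y L f < ∞) (s : Fin 2) :
    ∀ᵐ ω ∂(P[|S ⁻¹' {s}]), f (X ω, s) =
      quantile (groupLaw P X S f 0) (cdf (groupLaw P X S φ s) (φ (X ω, s))) := by
  obtain ⟨hfm, hfair, hmin⟩ := hf
  have : ∀ s, IsProbabilityMeasure (P[|S ⁻¹' {s}]) := fun s ↦ cond_isProbabilityMeasure (hr s)
  have hXs (s : Fin 2) : Measurable fun ω ↦ (X ω, s) := hX.prodMk measurable_const
  have hpair_of {g : E × Fin 2 → ℝ} (hg : Measurable g) (s : Fin 2) :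
      Measurable fun ω ↦ (φ (X ω, s), g (X ω, s)) :=
    (hφ.comp (hXs s)).prodMk (hg.comp (hXs s))
  have hpair := hpair_of hfm
  have hk : Measurable fun p : ℝ × ℝ ↦ ENNReal.ofReal (inducedCost L F p.1 p.2) :=
    hdiff.1.continuous.measurable.ennreal_ofReal
  have hrisk {g : E × Fin 2 → ℝ} (hg : Measurable g) :
      risk P X S Y L g = ∑ s, P (S ⁻¹' {s}) * planCost (inducedCost L F) (groupPlan P X S φ g s) :=
    (risk_eq_lintegral_inducedCost hX hS hY hL hφ hindep hF hC hg).trans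
      (lintegral_eq_sum_lintegral_groupPlan hX hS hr hφ hg
        (k := fun x y ↦ ENNReal.ofReal (inducedCost L F x y)) hk)
  have hplan (t : Fin 2) : planCost (inducedCost L F) (groupPlan P X S φ f t) ≠ ∞ := by
    rw [hrisk hfm, ENNReal.sum_lt_top] at hfin
    exact fun h ↦ (hfin t (Finset.mem_univ t)).ne (by rw [h, ENNReal.mul_top (hr t)])
  have hfst : (groupPlan P X S φ f s).map Prod.fst = groupLaw P X S φ s :=
    Measure.map_map measurable_fst (hpair s)
  have hsnd : (groupPlan P X S φ f s).map Prod.snd = groupLaw P X S f s :=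
    Measure.map_map measurable_snd (hpair s)
  have : IsProbabilityMeasure (groupPlan P X S φ f s) :=
    Measure.isProbabilityMeasure_map (hpair s).aemeasurable
  have : NullSingletonClass ((groupPlan P X S φ f s).map Prod.fst) := hfst ▸ hatom s
  have hs0 : groupLaw P X S f s = groupLaw P X S f 0 := by
    fin_cases s
    · rfl
    · exact hfair.symm
  rcases ae_eq_quantile_cdf_or_exists_planCost_lt hdiff hneg (inducedCost_nonneg L F)
    (groupPlan P X S φ f s) (hplan s) with h | ⟨G, hG, hGlaw, hlt⟩
  · rw [hfst, hsnd, hs0] at h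
    exact ae_of_ae_map (hpair s).aemeasurable h
  exfalso
  -- the improved coupling is that of a prediction function which differs from `f` in group `s` only
  set g : E × Fin 2 → ℝ := fun w ↦ if w.2 = s then G (φ w, f w) else f w with hgdef
  have hg : Measurable g :=
    Measurable.ite (measurable_snd (measurableSet_singleton s)) (hG.comp (hφ.prodMk hfm)) hfm
  have hgs : (fun ω ↦ g (X ω, s)) = G ∘ fun ω ↦ (φ (X ω, s), f (X ω, s)) := by
    ext ω; simp [hgdef]
  have hgne {t : Fin 2} (ht : t ≠ s) (x : E) : g (x, t) = f (x, t) := by simp [hgdef, ht]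
  have hlaw (t : Fin 2) : groupLaw P X S g t = groupLaw P X S f t := by
    rcases eq_or_ne t s with rfl | ht
    · rw [groupLaw, hgs, ← Measure.map_map hG (hpair t), ← hsnd]
      exact hGlaw
    · simp only [groupLaw, hgne ht]
  have hkG : Measurable fun p : ℝ × ℝ ↦ ENNReal.ofReal (inducedCost L F p.1 (G p)) :=
    hk.comp (measurable_fst.prodMk hG)
  have hcost_s : planCost (inducedCost L F) (groupPlan P X S φ g s) <
      planCost (inducedCost L F) (groupPlan P X S φ f s) := by
    refine lt_of_eq_of_lt ?_ hlt
    rw [planCost, groupPlan, groupPlan,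
      lintegral_map hk (hpair_of hg s),
      lintegral_map hkG (hpair s)]
    simp [hgdef]
  have hcost (t : Fin 2) (ht : t ≠ s) : planCost (inducedCost L F) (groupPlan P X S φ g t) =
      planCost (inducedCost L F) (groupPlan P X S φ f t) := by
    simp only [groupPlan, hgne ht]
  refine absurd (hmin g hg ((hlaw 0).trans (hfair.trans (hlaw 1).symm))) (not_le.2 ?_)
  rw [hrisk hg, hrisk hfm, ← Finset.add_sum_erase _ _ (Finset.mem_univ s),
    ← Finset.add_sum_erase _ (fun t ↦ _ * planCost _ (groupPlan P X S φ f t)) (Finset.mem_univ s),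
    Finset.sum_congr rfl fun t ht ↦ by rw [hcost t (Finset.ne_of_mem_erase ht)]]
  refine (ENNReal.add_lt_add_iff_right ?_).2
    ((ENNReal.mul_lt_mul_iff_right (hr s) (measure_ne_top _ _)).2 hcost_s)
  exact (ENNReal.sum_lt_top.2 fun t _ ↦
    ENNReal.mul_lt_top (measure_lt_top _ _) (hplan t).lt_top).ne

end Risk

end FairRegression

theorem proposition2
    {d : ℕ} {𝒳 : Set (EuclideanSpace ℝ (Fin d))}
    {Ω : Type*} [MeasurableSpace Ω] (P : Measure Ω) [IsProbabilityMeasure P]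
    (X : Ω → 𝒳) (S : Ω → Fin 2) (Y : Ω → ℝ)
    (hX : Measurable X) (hS : Measurable S) (hY : Measurable Y)
    -- both groups have positive probability
    (hr : ∀ s, P (S ⁻¹' {s}) ≠ 0)
    -- the loss function
    (L : ℝ → ℝ → ℝ≥0) (hL : Measurable (fun p : ℝ × ℝ ↦ L p.1 p.2))
    -- `Y` depends on `(X, S)` only through `f*(X, S)`
    (fstar : 𝒳 × Fin 2 → ℝ) (hfstar : Measurable fstar)
    (hindep : FairRegression.CondIndepGiven P Y (fun ω ↦ (X ω, S ω))
      (fun ω ↦ fstar (X ω, S ω)))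
    -- `F(· | θ)` is the conditional distribution of `Y` given `f*(X, S) = θ`,
    -- and the induced cost is finite
    (F : Kernel ℝ ℝ) [IsMarkovKernel F]
    (hF : HasCondDistrib Y (fun ω ↦ fstar (X ω, S ω)) F P)
    (hC_int : ∀ x y : ℝ, Integrable (fun t ↦ (L y t : ℝ)) (F x))
    -- the induced cost is twice differentiable with negative mixed partial derivative
    (hC_diff : FairRegression.TwiceDifferentiable (FairRegression.inducedCost L F))
    (hC_mixed : ∀ x y : ℝ, FairRegression.mixedPartial (FairRegression.inducedCost L F) x y < 0)
    -- the group laws of `f*` are non-atomic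
    (hatom : ∀ s, NullSingletonClass (FairRegression.groupLaw P X S fstar s)) :
    -- every fair risk minimizer (of finite risk) lies in the class `{Q ∘ F*_s ∘ f*(x, s)}`
    (∀ f : 𝒳 × Fin 2 → ℝ,
      FairRegression.IsFairRiskMinimizer P X S Y L f →
      FairRegression.risk P X S Y L f < ∞ →
      ∃ Q : ℝ → ℝ, FairRegression.IsQuantileFunction Q ∧
        ∀ᵐ ω ∂P, f (X ω, S ω) =
          Q (cdf (FairRegression.groupLaw P X S fstar (S ω)) (fstar (X ω, S ω)))) ∧
    -- the optimal transport maps to a barycenter have the form `T_s = Q_ν ∘ F*_s`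
    (∀ (ν : Measure ℝ) (T : Fin 2 → ℝ → ℝ),
      FairRegression.IsKantorovichBarycenter (FairRegression.inducedCost L F)
        (fun s ↦ P (S ⁻¹' {s})) (FairRegression.groupLaw P X S fstar) ν →
      (∀ s, FairRegression.IsOptimalTransportMap (FairRegression.inducedCost L F)
        (FairRegression.groupLaw P X S fstar s) ν (T s)) →
      ∀ s, ∀ᵐ x ∂(FairRegression.groupLaw P X S fstar s),
        T s x = FairRegression.quantile ν (cdf (FairRegression.groupLaw P X S fstar s) x)) := by
  have hcond (s : Fin 2) : IsProbabilityMeasure (P[|S ⁻¹' {s}]) := cond_isProbabilityMeasure (hr s)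
  have hprob (s : Fin 2) : IsProbabilityMeasure (FairRegression.groupLaw P X S fstar s) :=
    Measure.isProbabilityMeasure_map (hfstar.comp (hX.prodMk measurable_const)).aemeasurable
  refine ⟨fun f hf hfin ↦ ?_, fun ν T hν hT s ↦ ?_⟩
  · have hlaw : IsProbabilityMeasure (FairRegression.groupLaw P X S f 0) :=
      Measure.isProbabilityMeasure_map (hf.1.comp (hX.prodMk measurable_const)).aemeasurable
    refine ⟨FairRegression.quantile (FairRegression.groupLaw P X S f 0),
      ⟨_, hlaw, fun _ _ ↦ rfl⟩, ?_⟩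
    have hgroup : ∀ᵐ ω ∂P, ∀ s, S ω = s → f (X ω, s) =
        FairRegression.quantile (FairRegression.groupLaw P X S f 0)
          (cdf (FairRegression.groupLaw P X S fstar s) (fstar (X ω, s))) := by
      refine ae_all_iff.2 fun s ↦ ?_
      have h := hf.ae_eq_quantile_cdf hX hS hY hr hL hfstar hindep hF hC_int hC_diff hC_mixed
        hatom hfin s
      refine (ae_restrict_iff' (hS (measurableSet_singleton s))).1 ?_
      exact (Measure.ae_ennreal_smul_measure_iff (ENNReal.inv_ne_zero.2 (measure_ne_top P _))).1 h
    filter_upwards [hgroup] with ω hω using hω (S ω) rfl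
  · refine FairRegression.optimalTransportMap_ae_eq_quantile_cdf hC_diff hC_mixed
      (FairRegression.inducedCost_nonneg L F) (hT s) fun h ↦ ?_
    refine (ENNReal.sum_lt_top.1 hν.2.1 s (Finset.mem_univ s)).ne ?_
    rw [h, ENNReal.mul_top (hr s)]
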